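/- Let $d\ge 1$, $M\ge 0$ and $n\ge 0$ be integers. Let $X^*$ be a random vector in $\mathbb{R}^d$ with (prior) density $p_0$ whose differential entropy $H(p_0)=-\int p_0(x)\log p_0(x)\,dx$ exists and is finite (natural logarithm). In each cycle $k=0,1,2,\dots$ a controller asks $M$ players, $m=1,\dots,M$, whether $X^*$ lies in measurable query regions $A_k^{(m)}\subseteq\mathbb{R}^d$ (for instance finite unions of half-open rectangles), and receives responses $Y_{k+1}^{(m)}\in\{0,1\}$. Under a joint policy the $M$ regions of cycle $k$ are functions of the responses of the previous cycles; under a sequential policy the region for player $m$ may depend in addition on the responses of players $1,\dots,m-1$ in cycle $k$. In both cases the regions may also depend measurably on a random seed that is independent of $X^*$. Given $X^*$, the seed and the past, the responses are (conditionally independent) outputs of memoryless binary symmetric channels: $Y_{k+1}^{(m)}$ differs from the true answer $\mathbf{1}\{X^*\in A_k^{(m)}\}$ with probability $\epsilon_m\in(0,1/2)$; for a joint policy the $M$ responses of a cycle are conditionally independent given $X^*$, the seed and the responses of the previous cycles, and for a sequential policy the response of player $m$ is conditioned on $X^*$, the seed and all earlier responses. Let $p_n$ be the posterior density of $X^*$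 after $n$ cycles and let $X_n$ be a (coordinatewise) median of $p_n$. Then, for every joint and every sequential policy, $$\mathbb{E}\,\|X^*-X_n\|_2^2\;\ge\;\frac{K}{2\pi e}\,d\,\exp\!\left(-\frac{2nC}{d}\right),\qquad K=e^{2H(p_0)/d},\quad C=\sum_{m=1}^M C(\epsilon_m),$$ where $C(\epsilon)=\log 2+\epsilon\log\epsilon+(1-\epsilon)\log(1-\epsilon)$ is the capacity, in nats, of the binary symmetric channel with crossover probability $\epsilon$. The same bound holds with $X_n$ replaced by any estimator that is a measurable function of the seed and of the responses of the first $n$ cycles. (The mean-square error may be $+\infty$.) -/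

import Mathlib

open MeasureTheory ProbabilityTheory
open scoped ENNReal

noncomputable section

namespace TwentyQuestions

/-- The target space `ℝ^d` with the Euclidean norm. -/
abbrev Space (d : ℕ) : Type := EuclideanSpace ℝ (Fin d)

/-- Differential entropy (in nats) `H(p) = -∫ p(x) log p(x) dx`. -/
def diffEntropy {d : ℕ} (p : Space d → ℝ) : ℝ :=
  -∫ x, p x * Real.log (p x)

/-- The entropy integral converges absolutely, i.e. `H(p)` exists and is finite. -/
def HasFiniteEntropy {d : ℕ} (p : Space d → ℝ) : Prop :=
  Integrable (fun x => p x * Real.log (p x))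

/-- Capacity (in nats) of the binary symmetric channel with crossover probability `ε`. -/
def capacity (ε : ℝ) : ℝ :=
  Real.log 2 - Real.binEntropy ε

/-- Transition probability `P(response = y | true answer = z)` of the binary symmetric channel. -/
def bsc (ε : ℝ) (z y : Bool) : ℝ :=
  if y = z then 1 - ε else ε

open Classical in
/-- The truthful answer to the query "does `x` lie in `A`?". -/
def answer {d : ℕ} (A : Set (Space d)) (x : Space d) : Bool :=
  decide (x ∈ A)

/-- Responses of all `M` players in the first `k` cycles. -/
abbrev Record (M k : ℕ) : Type := Fin k → Fin M → Bool

/-- A joint policy: in cycle `k` the `M` queries are chosen together, as a function of the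
responses of the previous cycles (and of an optional random seed in `𝒰`; a deterministic policy is
one with `𝒰` a single point). Query regions are measurable, jointly with the seed. -/
structure JointPolicy (d M : ℕ) (𝒰 : Type*) [MeasurableSpace 𝒰] where
  query : (k : ℕ) → Record M k → 𝒰 → Fin M → Set (Space d)
  measurableSet_query : ∀ (k : ℕ) (h : Record M k) (m : Fin M),
    MeasurableSet {q : 𝒰 × Space d | q.2 ∈ query k h q.1 m}

/-- A sequential policy: in cycle `k` the query to player `t` may depend on the responses of the
previous cycles and also on the responses of players `0, …, t - 1` in the current cycle. -/
structure SequentialPolicy (d M : ℕ) (𝒰 : Type*) [MeasurableSpace 𝒰] where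
  query : (k : ℕ) → (t : Fin M) → Record M k → (Fin (t : ℕ) → Bool) → 𝒰 → Set (Space d)
  measurableSet_query : ∀ (k : ℕ) (t : Fin M) (h : Record M k) (h' : Fin (t : ℕ) → Bool),
    MeasurableSet {q : 𝒰 × Space d | q.2 ∈ query k t h h' q.1}

section Game

variable {Ω 𝒰 : Type*} [MeasurableSpace Ω] [MeasurableSpace 𝒰] {d M : ℕ}

/-- The responses of the first `k` cycles in the outcome `ω`. -/
def record (Y : ℕ → Ω → Fin M → Bool) (k : ℕ) (ω : Ω) : Record M k :=
  fun j m => Y j ω m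

/-- The responses of players `0, …, t - 1` in cycle `k` in the outcome `ω`. -/
def partialRecord (Y : ℕ → Ω → Fin M → Bool) (k : ℕ) (t : Fin M) (ω : Ω) : Fin (t : ℕ) → Bool :=
  fun s => Y k ω ⟨s, s.isLt.trans t.isLt⟩

/-- The queries that a joint policy poses in cycle `k` in the outcome `ω`. -/
def JointPolicy.asked (ζ : JointPolicy d M 𝒰) (U : Ω → 𝒰) (Y : ℕ → Ω → Fin M → Bool)
    (ω : Ω) (k : ℕ) (m : Fin M) : Set (Space d) :=
  ζ.query k (record Y k ω) (U ω) m

/-- The queries that a sequential policy poses in cycle `k` in the outcome `ω`. -/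
def SequentialPolicy.asked (ζ : SequentialPolicy d M 𝒰) (U : Ω → 𝒰) (Y : ℕ → Ω → Fin M → Bool)
    (ω : Ω) (k : ℕ) (t : Fin M) : Set (Space d) :=
  ζ.query k t (record Y k ω) (partialRecord Y k t ω) (U ω)

/-- The σ-algebra generated by the target, the seed and the responses of the first `k` cycles. -/
abbrev jointPast (X : Ω → Space d) (U : Ω → 𝒰) (Y : ℕ → Ω → Fin M → Bool) (k : ℕ) :
    MeasurableSpace Ω :=
  MeasurableSpace.comap (fun ω => (X ω, U ω, record Y k ω)) inferInstance

/-- The σ-algebra generated by the target, the seed, the responses of the first `k` cycles and the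
responses of players `0, …, t - 1` in cycle `k`. -/
abbrev sequentialPast (X : Ω → Space d) (U : Ω → 𝒰) (Y : ℕ → Ω → Fin M → Bool) (k : ℕ)
    (t : Fin M) : MeasurableSpace Ω :=
  MeasurableSpace.comap (fun ω => (X ω, U ω, record Y k ω, partialRecord Y k t ω)) inferInstance

/-- The probability that the players return the vector `y` to the queries `A` when the target is
at `x`: independent binary symmetric channels with crossover probabilities `ε m`. -/
def likelihood (ε : Fin M → ℝ) (A : Fin M → Set (Space d)) (y : Fin M → Bool) (x : Space d) : ℝ :=
  ∏ m, bsc (ε m) (answer (A m) x) (y m)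

/-- The target `X` has prior density `p₀` and is independent of the controller's seed `U`. -/
structure IsTargetModel (P : Measure Ω) (p₀ : Space d → ℝ) (X : Ω → Space d) (U : Ω → 𝒰)
    (Y : ℕ → Ω → Fin M → Bool) : Prop where
  measurable_target : Measurable X
  measurable_seed : Measurable U
  measurable_response : ∀ k, Measurable (Y k)
  measurable_prior : Measurable p₀
  prior_nonneg : ∀ x, 0 ≤ p₀ x
  map_target : P.map X = (volume : Measure (Space d)).withDensity (fun x => ENNReal.ofReal (p₀ x))
  indep_seed : IndepFun U X P

/-- Under a joint policy the responses of a cycle are, conditionally on the target and the past,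
independent outputs of memoryless binary symmetric channels fed with the true answers. -/
def IsJointGame (P : Measure Ω) (ε : Fin M → ℝ) (ζ : JointPolicy d M 𝒰) (X : Ω → Space d)
    (U : Ω → 𝒰) (Y : ℕ → Ω → Fin M → Bool) : Prop :=
  ∀ (k : ℕ) (y : Fin M → Bool),
    P⟦{ω | Y k ω = y} | jointPast X U Y k⟧ =ᵐ[P]
      fun ω => likelihood ε (ζ.asked U Y ω k) y (X ω)

/-- Under a sequential policy each single response is, conditionally on the target and the past,
the output of a memoryless binary symmetric channel fed with the true answer. -/
def IsSequentialGame (P : Measure Ω) (ε : Fin M → ℝ) (ζ : SequentialPolicy d M 𝒰)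
    (X : Ω → Space d) (U : Ω → 𝒰) (Y : ℕ → Ω → Fin M → Bool) : Prop :=
  ∀ (k : ℕ) (t : Fin M) (b : Bool),
    P⟦{ω | Y k ω t = b} | sequentialPast X U Y k t⟧ =ᵐ[P]
      fun ω => bsc (ε t) (answer (ζ.asked U Y ω k t) (X ω)) b

/-- Posterior density after `n` cycles by Bayes' rule, for queries `A` and responses `y`.
(Updating player by player within a cycle and normalizing each time gives the same density.) -/
def posterior (p₀ : Space d → ℝ) (ε : Fin M → ℝ) (A : ℕ → Fin M → Set (Space d))
    (y : ℕ → Fin M → Bool) : ℕ → Space d → ℝ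
  | 0 => p₀
  | n + 1 => fun x =>
      likelihood ε (A n) (y n) x * posterior p₀ ε A y n x /
        ∫ z, likelihood ε (A n) (y n) z * posterior p₀ ε A y n z

/-- `m` is a (coordinatewise) median of the probability density `p`; for `d = 1` this is the usual
notion. -/
def IsMedian (p : Space d → ℝ) (m : Space d) : Prop :=
  ∀ i, 1 / 2 ≤ ∫ x in {x | x i ≤ m i}, p x ∧ 1 / 2 ≤ ∫ x in {x | m i ≤ x i}, p x

/-- An estimator of the target after `n` cycles: a function of the responses of those cycles and of
the seed (which together determine the queries), measurable in the seed. -/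
structure Estimator (d M : ℕ) (𝒰 : Type*) [MeasurableSpace 𝒰] (n : ℕ) where
  toFun : Record M n → 𝒰 → Space d
  measurable_toFun : ∀ h, Measurable (toFun h)

/-- The estimate produced in the outcome `ω`. -/
def Estimator.estimate {n : ℕ} (e : Estimator d M 𝒰 n) (U : Ω → 𝒰) (Y : ℕ → Ω → Fin M → Bool)
    (ω : Ω) : Space d :=
  e.toFun (record Y n ω) (U ω)

/-- Mean-square error `E‖X - X̂‖²`, possibly infinite. -/
def mse (P : Measure Ω) (X X' : Ω → Space d) : ℝ≥0∞ :=
  ∫⁻ ω, ENNReal.ofReal (‖X ω - X' ω‖ ^ 2) ∂P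

/-- The lower bound `(K / (2πe)) d exp(-2nC/d)` with `K = exp(2 H(p₀) / d)` and
`C = ∑ m, C(ε m)`. -/
def mseBound (p₀ : Space d → ℝ) (ε : Fin M → ℝ) (n : ℕ) : ℝ :=
  Real.exp (2 * diffEntropy p₀ / d) / (2 * Real.pi * Real.exp 1) * d *
    Real.exp (-(2 * n * ∑ m, capacity (ε m)) / d)

end Game

end TwentyQuestions

end

/-! The bound is Gibbs' inequality for one well-chosen reference law. Fix an estimator and b > 0.
Compare the true law of seed, target and responses with the law in which the seed keeps its
distribution, the record is uniform on its N = 2^(nM) values, and the target is Gaussian with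
variance 1/(2b) per coordinate around the estimate. With g the Gaussian density and ℓ the likelihood
of the record given seed and target, the density ratio is Z = g / (p₀ N ℓ). It satisfies E Z ≤ 1, so
log Z ≤ Z - 1 gives E log Z ≤ 0.

Two facts make E log Z explicit. A binary symmetric channel has output entropy h(ε) for either
input, so by the chain rule the record has conditional entropy n ∑ h(ε m) given seed and target,
whatever the policy asks; together with log N = nM log 2 this produces nC. And -log g is quadratic
in the error, so its mean is (d/2) log(π/b) + b · MSE. Hence H(p₀) - nC ≤ (d/2) log(π/b) + b · MSE
(`HasResponseLaw.entropy_le`), and the best b yields the theorem.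

Joint and sequential games enter only through `HasResponseLaw`, which says that cycle likelihoods
are the conditional probabilities of the responses. A bound for arbitrary estimators covers the
posterior median. -/

namespace TwentyQuestions

/-! ### Laws of strings drawn letter by letter, and their entropy -/

/-- The probability of the string `h` when its letters are drawn one after another, the `k`-th
letter from the distribution `ℓ k s` given the string `s` of the earlier letters. -/
noncomputable def chainProd {α : Type*} {n : ℕ} (ℓ : (k : Fin n) → (Fin (k : ℕ) → α) → α → ℝ)
    (h : Fin n → α) : ℝ :=
  ∏ k, ℓ k (fun j => h ⟨j, j.isLt.trans k.isLt⟩) (h k)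

/-- Earlier factors see only the prefix, so appending a letter leaves them unchanged. The inductions
on string length rest on this. -/
theorem chainProd_snoc {α : Type*} {n : ℕ}
    (ℓ : (k : Fin (n + 1)) → (Fin (k : ℕ) → α) → α → ℝ) (h : Fin n → α) (a : α) :
    chainProd ℓ (Fin.snoc (α := fun _ => α) h a) =
      chainProd (fun k : Fin n => ℓ k.castSucc) h * ℓ (Fin.last n) h a := by
  have key : ∀ j : Fin (n + 1), ∀ hj : (j : ℕ) < n,
      Fin.snoc (α := fun _ => α) h a j = h ⟨j, hj⟩ := by
    intro j hj
    simp [Fin.snoc, hj, Fin.castLT]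
  unfold chainProd
  rw [Fin.prod_univ_castSucc]
  congr 1
  · refine Finset.prod_congr rfl fun k _ => ?_
    rw [Fin.snoc_castSucc]
    congr 1
    funext j
    exact key _ (j.isLt.trans k.isLt)
  · rw [Fin.snoc_last]
    congr 1
    funext j
    exact key _ j.isLt

theorem chainProd_pos {α : Type*} {n : ℕ} {ℓ : (k : Fin n) → (Fin (k : ℕ) → α) → α → ℝ}
    (hℓ : ∀ k s a, 0 < ℓ k s a) (h : Fin n → α) : 0 < chainProd ℓ h :=
  Finset.prod_pos fun _ _ => hℓ _ _ _

theorem sum_snoc {α β : Type*} [Fintype α] [AddCommMonoid β] {n : ℕ} (f : (Fin (n + 1) → α) → β) :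
    ∑ h, f h = ∑ h : Fin n → α, ∑ a, f (Fin.snoc (α := fun _ => α) h a) := by
  rw [← (Fin.snocEquiv fun _ : Fin (n + 1) => α).sum_comp, Fintype.sum_prod_type, Finset.sum_comm]
  rfl

theorem sum_chainProd {α : Type*} [Fintype α] {n : ℕ}
    (ℓ : (k : Fin n) → (Fin (k : ℕ) → α) → α → ℝ) (hsum : ∀ k s, ∑ a, ℓ k s a = 1) :
    ∑ h, chainProd ℓ h = 1 := by
  induction n with
  | zero => simp [chainProd]
  | succ n ih =>
    rw [sum_snoc]
    simp_rw [chainProd_snoc, ← Finset.mul_sum, hsum, mul_one]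
    exact ih (fun k => ℓ k.castSucc) fun k s => hsum k.castSucc s

/-- Chain rule for the Shannon entropy when the conditional entropies are constant. -/
theorem sum_negMulLog_chainProd {α : Type*} [Fintype α] {n : ℕ}
    (ℓ : (k : Fin n) → (Fin (k : ℕ) → α) → α → ℝ) (e : Fin n → ℝ)
    (hsum : ∀ k s, ∑ a, ℓ k s a = 1) (hent : ∀ k s, ∑ a, Real.negMulLog (ℓ k s a) = e k) :
    ∑ h, Real.negMulLog (chainProd ℓ h) = ∑ k, e k := by
  induction n with
  | zero => simp [chainProd]
  | succ n ih =>
    have h1 := sum_chainProd (fun k : Fin n => ℓ k.castSucc) fun k s => hsum k.castSucc s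
    have h2 := ih (fun k => ℓ k.castSucc) (fun k => e k.castSucc)
      (fun k s => hsum k.castSucc s) fun k s => hent k.castSucc s
    rw [sum_snoc, Fin.sum_univ_castSucc]
    -- With η(x) = -x log x, η(xy) = y η(x) + x η(y). Summing over the last letter turns the first
    -- term into η of the prefix probability and the second into that probability times a constant
    -- entropy.
    simp_rw [chainProd_snoc, Real.negMulLog_mul, Finset.sum_add_distrib, ← Finset.sum_mul,
      ← Finset.mul_sum, hsum, hent, ← Finset.sum_mul, h1, one_mul, h2]

/-! ### The binary symmetric channel -/

theorem bsc_pos {ε : ℝ} (hε : ε ∈ Set.Ioo (0 : ℝ) (1 / 2)) (z y : Bool) : 0 < bsc ε z y := by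
  obtain ⟨h1, h2⟩ := hε
  unfold bsc
  split_ifs <;> linarith

theorem sum_bsc (ε : ℝ) (z : Bool) : ∑ y, bsc ε z y = 1 := by
  cases z <;> simp [bsc]

/-- The value does not depend on the input `z`: flipping it only swaps the two output probabilities.
This is why adaptive queries cannot change the noise entropy. -/
theorem sum_negMulLog_bsc (ε : ℝ) (z : Bool) :
    ∑ y, Real.negMulLog (bsc ε z y) = Real.binEntropy ε := by
  rw [Real.binEntropy_eq_negMulLog_add_negMulLog_one_sub]
  cases z <;> simp [bsc, add_comm]

/-! ### From conditional probabilities to weighted integrals -/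

/-- Integrating a function measurable with respect to the conditioning σ-algebra over an event
amounts to weighting it with the conditional probability of that event. -/
theorem setLIntegral_eq_of_condExp_indicator {Ω : Type*} {m m₀ : MeasurableSpace Ω}
    {P : Measure Ω} [IsProbabilityMeasure P] (hm : m ≤ m₀) {E : Set Ω} (hE : MeasurableSet E)
    {f : Ω → ℝ} (hf : P⟦E | m⟧ =ᵐ[P] f) {w : Ω → ℝ≥0∞} (hw : Measurable[m] w) :
    ∫⁻ ω in E, w ω ∂P = ∫⁻ ω, ENNReal.ofReal (f ω) * w ω ∂P := by
  set g : Ω → ℝ := P⟦E | m⟧ with hg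
  have hint : Integrable (E.indicator fun _ => (1 : ℝ)) P :=
    (integrable_const (1 : ℝ)).indicator hE
  have hgm : Measurable[m] fun ω => ENNReal.ofReal (g ω) :=
    ENNReal.measurable_ofReal.comp stronglyMeasurable_condExp.measurable
  have hg0 : 0 ≤ᵐ[P] g :=
    condExp_nonneg (Filter.Eventually.of_forall fun ω => Set.indicator_nonneg (by simp) ω)
  -- On `m`-measurable sets both measures agree by the defining property of conditional expectation;
  -- an `m`-measurable integrand sees only these trims.
  have key : (P.restrict E).trim hm = (P.withDensity fun ω => ENNReal.ofReal (g ω)).trim hm := by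
    refine @Measure.ext _ m _ _ fun s hs => ?_
    rw [trim_measurableSet_eq hm hs, trim_measurableSet_eq hm hs,
      Measure.restrict_apply (hm s hs), withDensity_apply _ (hm s hs),
      ← ofReal_integral_eq_lintegral_ofReal integrable_condExp.integrableOn
        (ae_restrict_of_ae hg0), setIntegral_condExp hm hint hs,
      setIntegral_indicator hE]
    simp
  calc ∫⁻ ω in E, w ω ∂P = ∫⁻ ω, w ω ∂(P.restrict E).trim hm := (lintegral_trim hm hw).symm
    _ = ∫⁻ ω, w ω ∂(P.withDensity fun ω => ENNReal.ofReal (g ω)) := by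
        rw [key, lintegral_trim hm hw]
    _ = ∫⁻ ω, ENNReal.ofReal (g ω) * w ω ∂P :=
        lintegral_withDensity_eq_lintegral_mul _ (hgm.mono hm le_rfl) (hw.mono hm le_rfl)
    _ = _ := by
        refine lintegral_congr_ae ?_
        filter_upwards [hf] with ω hω
        rw [hω]

/-! ### Likelihood of the responses under a policy -/

section Law

variable {Ω 𝒰 : Type*} [MeasurableSpace Ω] [MeasurableSpace 𝒰] {d M : ℕ}

/-- A joint policy is a sequential one that ignores the responses of the current cycle. -/
def JointPolicy.toSequential (ζ : JointPolicy d M 𝒰) : SequentialPolicy d M 𝒰 where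
  query k t h _ u := ζ.query k h u t
  measurableSet_query k t h _ := ζ.measurableSet_query k h t

namespace SequentialPolicy

/-- Probability of the responses `y` in cycle `k`, given the earlier responses, seed and target. -/
noncomputable def cycleLikelihood (ζ : SequentialPolicy d M 𝒰) (ε : Fin M → ℝ) (q : 𝒰 × Space d)
    (k : ℕ) (h : Record M k) (y : Fin M → Bool) : ℝ :=
  chainProd (fun t s b => bsc (ε t) (answer (ζ.query k t h s q.1) q.2) b) y

/-- Probability of the responses `h` in the first `n` cycles, given seed and target. -/
noncomputable def recordLikelihood (ζ : SequentialPolicy d M 𝒰) (ε : Fin M → ℝ) {n : ℕ}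
    (h : Record M n) (q : 𝒰 × Space d) : ℝ :=
  chainProd (fun k : Fin n => ζ.cycleLikelihood ε q k) h

variable (ζ : SequentialPolicy d M 𝒰) {ε : Fin M → ℝ}

theorem measurable_bsc_answer (e : ℝ) (k : ℕ) (t : Fin M) (h : Record M k)
    (s : Fin (t : ℕ) → Bool) (b : Bool) :
    Measurable fun q : 𝒰 × Space d => bsc e (answer (ζ.query k t h s q.1) q.2) b := by
  refine (measurable_of_countable fun z => bsc e z b).comp ?_
  classical
  refine measurable_to_bool ?_
  convert ζ.measurableSet_query k t h s using 1
  ext q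
  simp [answer]

theorem measurable_cycleLikelihood (ε : Fin M → ℝ) (k : ℕ) (h : Record M k) (y : Fin M → Bool) :
    Measurable fun q => ζ.cycleLikelihood ε q k h y := by
  unfold cycleLikelihood chainProd
  exact Finset.measurable_prod _ fun _ _ => ζ.measurable_bsc_answer _ _ _ _ _ _

theorem measurable_recordLikelihood (ε : Fin M → ℝ) {n : ℕ} (h : Record M n) :
    Measurable (ζ.recordLikelihood ε h) := by
  unfold recordLikelihood chainProd
  exact Finset.measurable_prod _ fun _ _ => ζ.measurable_cycleLikelihood _ _ _ _

theorem cycleLikelihood_pos (hε : ∀ m, ε m ∈ Set.Ioo (0 : ℝ) (1 / 2)) (q : 𝒰 × Space d)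
    (k : ℕ) (h : Record M k) (y : Fin M → Bool) : 0 < ζ.cycleLikelihood ε q k h y :=
  chainProd_pos (fun t _ _ => bsc_pos (hε t) _ _) _

theorem recordLikelihood_pos (hε : ∀ m, ε m ∈ Set.Ioo (0 : ℝ) (1 / 2)) {n : ℕ} (h : Record M n)
    (q : 𝒰 × Space d) : 0 < ζ.recordLikelihood ε h q :=
  chainProd_pos (fun _ _ _ => ζ.cycleLikelihood_pos hε _ _ _ _) _

theorem sum_cycleLikelihood (ε : Fin M → ℝ) (q : 𝒰 × Space d) (k : ℕ) (h : Record M k) :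
    ∑ y, ζ.cycleLikelihood ε q k h y = 1 :=
  sum_chainProd _ fun _ _ => sum_bsc _ _

theorem sum_recordLikelihood (ε : Fin M → ℝ) (n : ℕ) (q : 𝒰 × Space d) :
    ∑ h : Record M n, ζ.recordLikelihood ε h q = 1 :=
  sum_chainProd _ fun _ _ => ζ.sum_cycleLikelihood _ _ _ _

theorem recordLikelihood_le_one (hε : ∀ m, ε m ∈ Set.Ioo (0 : ℝ) (1 / 2)) {n : ℕ}
    (h : Record M n) (q : 𝒰 × Space d) : ζ.recordLikelihood ε h q ≤ 1 := by
  rw [← ζ.sum_recordLikelihood ε n q]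
  exact Finset.single_le_sum (f := fun h => ζ.recordLikelihood ε h q)
    (fun h _ => (ζ.recordLikelihood_pos hε h q).le) (Finset.mem_univ h)

theorem sum_negMulLog_recordLikelihood (ε : Fin M → ℝ) (n : ℕ) (q : 𝒰 × Space d) :
    ∑ h : Record M n, Real.negMulLog (ζ.recordLikelihood ε h q) =
      n * ∑ m, Real.binEntropy (ε m) := by
  have := sum_negMulLog_chainProd (fun k : Fin n => ζ.cycleLikelihood ε q k)
    (fun _ => ∑ m, Real.binEntropy (ε m)) (fun _ _ => ζ.sum_cycleLikelihood _ _ _ _)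
    (fun _ _ => sum_negMulLog_chainProd _ _ (fun _ _ => sum_bsc _ _)
      fun _ _ => sum_negMulLog_bsc _ _)
  simpa [recordLikelihood] using this

end SequentialPolicy

/-! ### The response law of both kinds of game -/

/-- Given seed, target and earlier responses, the responses of each cycle are distributed according
to the likelihood of that cycle. -/
def HasResponseLaw (P : Measure Ω) (ε : Fin M → ℝ) (ζ : SequentialPolicy d M 𝒰)
    (X : Ω → Space d) (U : Ω → 𝒰) (Y : ℕ → Ω → Fin M → Bool) : Prop :=
  ∀ (k : ℕ) (h : Record M k) (y : Fin M → Bool) (w : 𝒰 × Space d → ℝ≥0∞), Measurable w →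
    ∫⁻ ω in {ω | record Y k ω = h ∧ Y k ω = y}, w (U ω, X ω) ∂P =
      ∫⁻ ω in {ω | record Y k ω = h},
        ENNReal.ofReal (ζ.cycleLikelihood ε (U ω, X ω) k h y) * w (U ω, X ω) ∂P

variable {P : Measure Ω} {p₀ : Space d → ℝ} {ε : Fin M → ℝ} {X : Ω → Space d} {U : Ω → 𝒰}
  {Y : ℕ → Ω → Fin M → Bool}

theorem measurable_record (hY : ∀ k, Measurable (Y k)) (k : ℕ) : Measurable (record Y k) :=
  measurable_pi_lambda _ fun j => hY j

theorem measurable_partialRecord (hY : ∀ k, Measurable (Y k)) (k : ℕ) (t : Fin M) :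
    Measurable (partialRecord Y k t) :=
  measurable_pi_lambda _ fun _ => (measurable_pi_apply _).comp (hY k)

theorem setLIntegral_indicator_inter {s t : Set Ω} (hs : MeasurableSet s) (w : Ω → ℝ≥0∞) :
    ∫⁻ ω in t, s.indicator w ω ∂P = ∫⁻ ω in s ∩ t, w ω ∂P := by
  rw [lintegral_indicator hs, Measure.restrict_restrict hs]

theorem IsJointGame.hasResponseLaw [IsProbabilityMeasure P] {ζ : JointPolicy d M 𝒰}
    (hmodel : IsTargetModel P p₀ X U Y) (hgame : IsJointGame P ε ζ X U Y) :
    HasResponseLaw P ε ζ.toSequential X U Y := by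
  intro k h y w hw
  have hR := measurable_record hmodel.measurable_response k
  have hS : MeasurableSet {ω | record Y k ω = h} := hR (measurableSet_singleton h)
  have hE : MeasurableSet {ω | Y k ω = y} :=
    hmodel.measurable_response k (measurableSet_singleton y)
  have hm : jointPast X U Y k ≤ ‹MeasurableSpace Ω› :=
    (hmodel.measurable_target.prodMk (hmodel.measurable_seed.prodMk hR)).comap_le
  -- The event that the record equals `h` belongs to the past, so it can be absorbed into the
  -- weight.
  have hW : Measurable[jointPast X U Y k]
      ({ω | record Y k ω = h}.indicator fun ω => w (U ω, X ω)) := by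
    have : Measurable ({q : Space d × 𝒰 × Record M k | q.2.2 = h}.indicator
        fun q => w (q.2.1, q.1)) :=
      Measurable.indicator (by fun_prop)
        ((measurable_snd.comp measurable_snd) (measurableSet_singleton h))
    exact this.comp (comap_measurable _)
  have := setLIntegral_eq_of_condExp_indicator hm hE (hgame k y) hW
  rw [setLIntegral_indicator_inter hS] at this
  rw [Set.ofPred_and, this, ← lintegral_indicator hS]
  refine lintegral_congr fun ω => ?_
  by_cases hω : record Y k ω = h
  · rw [Set.indicator_of_mem (by exact hω), Set.indicator_of_mem (by exact hω)]
    -- On this event the queries asked are those prescribed for `h`, and the cycle likelihood of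
    -- `ζ.toSequential` unfolds to `likelihood`.
    subst hω
    rfl
  · rw [Set.indicator_of_notMem (by exact hω), Set.indicator_of_notMem (by exact hω), mul_zero]

/-- The game prescribes one response at a time; conditioning on the players successively multiplies
their channel probabilities. -/
theorem IsSequentialGame.hasResponseLaw [IsProbabilityMeasure P] {ζ : SequentialPolicy d M 𝒰}
    (hε : ∀ m, ε m ∈ Set.Ioo (0 : ℝ) (1 / 2))
    (hmodel : IsTargetModel P p₀ X U Y) (hgame : IsSequentialGame P ε ζ X U Y) :
    HasResponseLaw P ε ζ X U Y := by
  intro k h y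
  have hR := measurable_record hmodel.measurable_response k
  set b : Fin M → 𝒰 × Space d → ℝ := fun t q =>
    bsc (ε t) (answer (ζ.query k t h (fun s => y ⟨s, s.isLt.trans t.isLt⟩) q.1) q.2) (y t) with hb
  have hbm : ∀ t, Measurable fun q => ENNReal.ofReal (b t q) := fun t =>
    (ζ.measurable_bsc_answer _ _ _ _ _ _).ennreal_ofReal
  -- Induction on the number `t` of players whose responses are fixed. The weight stays arbitrary so
  -- that it can absorb the factor of the next player.
  have key : ∀ t : ℕ, t ≤ M → ∀ w : 𝒰 × Space d → ℝ≥0∞, Measurable w →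
      ∫⁻ ω in {ω | record Y k ω = h ∧ ∀ s : Fin M, (s : ℕ) < t → Y k ω s = y s},
          w (U ω, X ω) ∂P =
        ∫⁻ ω in {ω | record Y k ω = h},
          (∏ s : Fin M, if (s : ℕ) < t then ENNReal.ofReal (b s (U ω, X ω)) else 1) *
            w (U ω, X ω) ∂P := by
    intro t
    induction t with
    | zero => simp
    | succ t ih =>
      intro htM w hw
      let τ : Fin M := ⟨t, htM⟩
      set S : Set Ω := {ω | record Y k ω = h ∧ ∀ s : Fin M, (s : ℕ) < t → Y k ω s = y s} with hSdef
      have hS' : S = {ω | record Y k ω = h ∧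
          partialRecord Y k τ ω = fun s : Fin (τ : ℕ) => y ⟨s, s.isLt.trans τ.isLt⟩} := by
        ext ω
        refine and_congr_right fun _ => ⟨fun H => ?_, fun H s hs => ?_⟩
        · funext s
          exact H _ s.isLt
        · exact congrFun H ⟨s, hs⟩
      have hP := measurable_partialRecord hmodel.measurable_response k τ
      have hS : MeasurableSet S := by
        rw [hS']
        exact (hR (measurableSet_singleton _)).inter (hP (measurableSet_singleton _))
      have hE : MeasurableSet {ω | Y k ω τ = y τ} :=
        ((measurable_pi_apply τ).comp (hmodel.measurable_response k)) (measurableSet_singleton _)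
      have hm : sequentialPast X U Y k τ ≤ ‹MeasurableSpace Ω› :=
        (hmodel.measurable_target.prodMk
          (hmodel.measurable_seed.prodMk (hR.prodMk hP))).comap_le
      have hW : Measurable[sequentialPast X U Y k τ] (S.indicator fun ω => w (U ω, X ω)) := by
        have : Measurable ({q : Space d × 𝒰 × Record M k × (Fin (τ : ℕ) → Bool) |
            q.2.2 = (h, fun s : Fin (τ : ℕ) => y ⟨s, s.isLt.trans τ.isLt⟩)}.indicator
              fun q => w (q.2.1, q.1)) :=
          Measurable.indicator (by fun_prop)
            ((measurable_snd.comp measurable_snd) (measurableSet_singleton _))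
        convert this.comp (comap_measurable
          (fun ω => (X ω, U ω, record Y k ω, partialRecord Y k τ ω))) using 1
        rw [hS']
        funext ω
        simp [Set.indicator]
      have hstep := setLIntegral_eq_of_condExp_indicator hm hE (hgame k τ (y τ)) hW
      rw [setLIntegral_indicator_inter hS] at hstep
      have hset : {ω | record Y k ω = h ∧ ∀ s : Fin M, (s : ℕ) < t + 1 → Y k ω s = y s} =
          S ∩ {ω | Y k ω τ = y τ} := by
        ext ω
        simp only [hSdef, Set.mem_ofPred_eq, Set.mem_inter_iff, and_assoc]
        refine and_congr_right fun _ => ⟨fun H => ⟨fun s hs => H s (by omega), H τ (by simp [τ])⟩,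
          fun H s hs => ?_⟩
        rcases Nat.lt_succ_iff_lt_or_eq.mp hs with hs | hs
        · exact H.1 s hs
        · obtain rfl : s = τ := Fin.ext hs
          exact H.2
      rw [hset, hstep]
      have hcongr : ∀ ω, ENNReal.ofReal (bsc (ε τ) (answer (ζ.asked U Y ω k τ) (X ω)) (y τ)) *
            S.indicator (fun ω => w (U ω, X ω)) ω =
          S.indicator (fun ω => ENNReal.ofReal (b τ (U ω, X ω)) * w (U ω, X ω)) ω := by
        intro ω
        by_cases hω : ω ∈ S
        · rw [Set.indicator_of_mem hω, Set.indicator_of_mem hω]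
          rw [hS'] at hω
          simp only [hb, SequentialPolicy.asked]
          rw [hω.1, hω.2]
        · rw [Set.indicator_of_notMem hω, Set.indicator_of_notMem hω, mul_zero]
      simp_rw [hcongr]
      rw [lintegral_indicator hS,
        ih (by omega) (fun q => ENNReal.ofReal (b τ q) * w q) ((hbm τ).mul hw)]
      refine lintegral_congr fun ω => ?_
      rw [← mul_assoc]
      congr 1
      have hsplit : ∀ s : Fin M,
          (if (s : ℕ) < t + 1 then ENNReal.ofReal (b s (U ω, X ω)) else 1) =
          (if (s : ℕ) < t then ENNReal.ofReal (b s (U ω, X ω)) else 1) *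
            (if s = τ then ENNReal.ofReal (b s (U ω, X ω)) else 1) := by
        intro s
        by_cases h1 : (s : ℕ) < t
        · have h2 : s ≠ τ := fun h => by simp [h, τ] at h1
          simp [h1, h2, h1.trans (Nat.lt_succ_self t)]
        · by_cases h2 : s = τ
          · subst h2
            simp [τ]
          · have h3 : ¬ (s : ℕ) < t + 1 := fun h3 => h2 (Fin.ext (by simp [τ]; omega))
            simp [h1, h2, h3]
      simp_rw [hsplit, Finset.prod_mul_distrib]
      simp
  intro w hw
  have := key M le_rfl w hw
  convert this using 2
  · congr 1
    ext ω
    simp [funext_iff]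
  · funext ω
    congr 1
    simp only [Fin.is_lt, if_true]
    unfold SequentialPolicy.cycleLikelihood chainProd
    exact ENNReal.ofReal_prod_of_nonneg fun t _ => (bsc_pos (hε t) _ _).le

/-- The record of the first `n` cycles is distributed according to its likelihood. -/
theorem HasResponseLaw.setLIntegral_record {ζ : SequentialPolicy d M 𝒰}
    (hε : ∀ m, ε m ∈ Set.Ioo (0 : ℝ) (1 / 2)) (hlaw : HasResponseLaw P ε ζ X U Y) {n : ℕ}
    (h : Record M n) {w : 𝒰 × Space d → ℝ≥0∞} (hw : Measurable w) :
    ∫⁻ ω in {ω | record Y n ω = h}, w (U ω, X ω) ∂P =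
      ∫⁻ ω, ENNReal.ofReal (ζ.recordLikelihood ε h (U ω, X ω)) * w (U ω, X ω) ∂P := by
  induction n generalizing w with
  | zero =>
    have : {ω | record Y 0 ω = h} = Set.univ := Set.eq_univ_of_forall fun ω => Subsingleton.elim _ _
    simp [this, SequentialPolicy.recordLikelihood, chainProd]
  | succ n ih =>
    obtain ⟨h', y, rfl⟩ : ∃ h' y, h = Fin.snoc (α := fun _ => Fin M → Bool) h' y :=
      ⟨Fin.init h, h (Fin.last n), (Fin.snoc_init_self h).symm⟩
    have hset : {ω | record Y (n + 1) ω = Fin.snoc (α := fun _ => Fin M → Bool) h' y} =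
        {ω | record Y n ω = h' ∧ Y n ω = y} := by
      ext ω
      have : record Y (n + 1) ω =
          Fin.snoc (α := fun _ => Fin M → Bool) (record Y n ω) (Y n ω) := by
        funext j
        refine Fin.lastCases ?_ (fun j => ?_) j
        · rw [Fin.snoc_last]; rfl
        · rw [Fin.snoc_castSucc]; rfl
      simp only [Set.mem_ofPred_eq, this, Fin.snoc_inj]
    rw [hset, hlaw n h' y w hw,
      ih h' (w := fun q => ENNReal.ofReal (ζ.cycleLikelihood ε q n h' y) * w q)
        ((ζ.measurable_cycleLikelihood ε n h' y).ennreal_ofReal.mul hw)]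
    refine lintegral_congr fun ω => ?_
    have : ζ.recordLikelihood ε (Fin.snoc (α := fun _ => Fin M → Bool) h' y) (U ω, X ω) =
        ζ.recordLikelihood ε h' (U ω, X ω) * ζ.cycleLikelihood ε (U ω, X ω) n h' y :=
      chainProd_snoc (fun k : Fin (n + 1) => ζ.cycleLikelihood ε (U ω, X ω) k) h' y
    rw [this, ENNReal.ofReal_mul (ζ.recordLikelihood_pos hε _ _).le, mul_assoc]

/-- Splitting over the finitely many records eliminates the responses: what remains are integrals in
seed and target only. -/
theorem HasResponseLaw.lintegral_record {ζ : SequentialPolicy d M 𝒰}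
    (hε : ∀ m, ε m ∈ Set.Ioo (0 : ℝ) (1 / 2)) (hmodel : IsTargetModel P p₀ X U Y)
    (hlaw : HasResponseLaw P ε ζ X U Y) {n : ℕ}
    {w : Record M n → 𝒰 × Space d → ℝ≥0∞} (hw : ∀ h, Measurable (w h)) :
    ∫⁻ ω, w (record Y n ω) (U ω, X ω) ∂P =
      ∑ h, ∫⁻ ω, ENNReal.ofReal (ζ.recordLikelihood ε h (U ω, X ω)) * w h (U ω, X ω) ∂P := by
  classical
  have hR := measurable_record hmodel.measurable_response n
  have hUX : Measurable fun ω => (U ω, X ω) :=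
    hmodel.measurable_seed.prodMk hmodel.measurable_target
  have hS : ∀ h, MeasurableSet {ω | record Y n ω = h} := fun h => hR (measurableSet_singleton h)
  have : ∀ ω, w (record Y n ω) (U ω, X ω) =
      ∑ h, {ω | record Y n ω = h}.indicator (fun ω => w h (U ω, X ω)) ω := by
    intro ω
    simp [Set.indicator]
  simp_rw [this]
  have hwm : ∀ h, Measurable fun ω => w h (U ω, X ω) := fun h => (hw h).comp hUX
  rw [lintegral_finsetSum _ fun h _ => (hwm h).indicator (hS h)]
  refine Finset.sum_congr rfl fun h _ => ?_
  rw [lintegral_indicator (hS h), hlaw.setLIntegral_record hε h (hw h)]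

end Law

end TwentyQuestions

namespace TwentyQuestions

/-! ### Expected log-likelihood and log-prior -/

section LowerBound

variable {Ω 𝒰 : Type*} [MeasurableSpace Ω] [MeasurableSpace 𝒰] {d M : ℕ}
  {P : Measure Ω} {p₀ : Space d → ℝ} {ε : Fin M → ℝ} {X : Ω → Space d} {U : Ω → 𝒰}
  {Y : ℕ → Ω → Fin M → Bool}

theorem measurable_uncurry_record (hmodel : IsTargetModel P p₀ X U Y) {n : ℕ} {β : Type*}
    [MeasurableSpace β] {w : Record M n → 𝒰 × Space d → β} (hw : ∀ h, Measurable (w h)) :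
    Measurable fun ω => w (record Y n ω) (U ω, X ω) := by
  have : Measurable fun q : Record M n × 𝒰 × Space d => w q.1 q.2 :=
    measurable_from_prod_countable_right hw
  exact this.comp ((measurable_record hmodel.measurable_response n).prodMk
    (hmodel.measurable_seed.prodMk hmodel.measurable_target))

/-- The expected log-likelihood of the record is minus the entropy of the channel noise. -/
theorem HasResponseLaw.integral_log_recordLikelihood [IsProbabilityMeasure P]
    {ζ : SequentialPolicy d M 𝒰} (hε : ∀ m, ε m ∈ Set.Ioo (0 : ℝ) (1 / 2))
    (hmodel : IsTargetModel P p₀ X U Y) (hlaw : HasResponseLaw P ε ζ X U Y) (n : ℕ) :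
    Integrable (fun ω => Real.log (ζ.recordLikelihood ε (record Y n ω) (U ω, X ω))) P ∧
    ∫ ω, Real.log (ζ.recordLikelihood ε (record Y n ω) (U ω, X ω)) ∂P =
      -(n * ∑ m, Real.binEntropy (ε m)) := by
  set f : Ω → ℝ := fun ω => -Real.log (ζ.recordLikelihood ε (record Y n ω) (U ω, X ω)) with hf
  have hUX : Measurable fun ω => (U ω, X ω) :=
    hmodel.measurable_seed.prodMk hmodel.measurable_target
  have hlogm : ∀ h : Record M n, Measurable fun q => -Real.log (ζ.recordLikelihood ε h q) :=
    fun h => (ζ.measurable_recordLikelihood ε h).log.neg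
  have hfm : Measurable f := measurable_uncurry_record hmodel hlogm
  have hf0 : 0 ≤ f := fun ω => neg_nonneg.mpr (Real.log_nonpos
    (ζ.recordLikelihood_pos hε _ _).le (ζ.recordLikelihood_le_one hε _ _))
  have hB : 0 ≤ (n : ℝ) * ∑ m, Real.binEntropy (ε m) :=
    mul_nonneg (Nat.cast_nonneg n) (Finset.sum_nonneg fun m _ =>
      Real.binEntropy_nonneg (hε m).1.le (by linarith [(hε m).2]))
  have hlint : ∫⁻ ω, ENNReal.ofReal (f ω) ∂P =
      ENNReal.ofReal (n * ∑ m, Real.binEntropy (ε m)) := by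
    rw [hf, hlaw.lintegral_record hε hmodel
      (w := fun h q => ENNReal.ofReal (-Real.log (ζ.recordLikelihood ε h q)))
      (fun h => (hlogm h).ennreal_ofReal)]
    have hm : ∀ h : Record M n, Measurable fun ω =>
        ENNReal.ofReal (ζ.recordLikelihood ε h (U ω, X ω)) *
          ENNReal.ofReal (-Real.log (ζ.recordLikelihood ε h (U ω, X ω))) := fun h =>
      ((ζ.measurable_recordLikelihood ε h).comp hUX).ennreal_ofReal.mul
        ((hlogm h).comp hUX).ennreal_ofReal
    rw [← lintegral_finsetSum _ fun h _ => hm h]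
    -- For fixed seed and target, the sum over records is the entropy of the channel noise, which is
    -- constant in `ω`.
    have : ∀ ω, ∑ h : Record M n, ENNReal.ofReal (ζ.recordLikelihood ε h (U ω, X ω)) *
        ENNReal.ofReal (-Real.log (ζ.recordLikelihood ε h (U ω, X ω))) =
          ENNReal.ofReal (n * ∑ m, Real.binEntropy (ε m)) := by
      intro ω
      rw [← ζ.sum_negMulLog_recordLikelihood ε n (U ω, X ω), ENNReal.ofReal_sum_of_nonneg
        fun h _ => Real.negMulLog_nonneg (ζ.recordLikelihood_pos hε _ _).le
          (ζ.recordLikelihood_le_one hε _ _)]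
      refine Finset.sum_congr rfl fun h _ => ?_
      rw [← ENNReal.ofReal_mul (ζ.recordLikelihood_pos hε _ _).le, Real.negMulLog]
      congr 1
      ring
    simp_rw [this]
    simp
  have hint : Integrable f P := by
    refine (lintegral_ofReal_ne_top_iff_integrable hfm.aestronglyMeasurable
      (Filter.Eventually.of_forall hf0)).mp ?_
    rw [hlint]
    exact ENNReal.ofReal_ne_top
  have hval : ∫ ω, f ω ∂P = n * ∑ m, Real.binEntropy (ε m) := by
    rw [integral_eq_lintegral_of_nonneg_ae (Filter.Eventually.of_forall hf0)
      hfm.aestronglyMeasurable, hlint, ENNReal.toReal_ofReal hB]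
  rw [hf] at hint hval
  refine ⟨by simpa using hint.neg, ?_⟩
  rw [← hval, integral_neg, neg_neg]

theorem IsTargetModel.ae_prior_pos (hmodel : IsTargetModel P p₀ X U Y) :
    ∀ᵐ ω ∂P, 0 < p₀ (X ω) := by
  have : ∀ᵐ x ∂P.map X, 0 < p₀ x := by
    rw [hmodel.map_target, ae_withDensity_iff hmodel.measurable_prior.ennreal_ofReal]
    refine Filter.Eventually.of_forall fun x hx => ?_
    simpa using hx
  exact ae_of_ae_map hmodel.measurable_target.aemeasurable this

theorem IsTargetModel.integral_log_prior (hmodel : IsTargetModel P p₀ X U Y)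
    (hH : HasFiniteEntropy p₀) :
    Integrable (fun ω => Real.log (p₀ (X ω))) P ∧
      ∫ ω, Real.log (p₀ (X ω)) ∂P = -diffEntropy p₀ := by
  have hlog : Measurable fun x => Real.log (p₀ x) := hmodel.measurable_prior.log
  have hsmul : (fun x => (ENNReal.ofReal (p₀ x)).toReal • Real.log (p₀ x)) =
      fun x => p₀ x * Real.log (p₀ x) := by
    funext x
    rw [ENNReal.toReal_ofReal (hmodel.prior_nonneg x), smul_eq_mul]
  have hfin : ∀ᵐ x : Space d, ENNReal.ofReal (p₀ x) < ∞ :=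
    Filter.Eventually.of_forall fun x => ENNReal.ofReal_lt_top
  constructor
  · refine (integrable_map_measure hlog.aestronglyMeasurable
      hmodel.measurable_target.aemeasurable).mp ?_
    rw [hmodel.map_target, integrable_withDensity_iff_integrable_smul'
      hmodel.measurable_prior.ennreal_ofReal hfin, hsmul]
    exact hH
  · rw [← integral_map hmodel.measurable_target.aemeasurable hlog.aestronglyMeasurable,
      hmodel.map_target, integral_withDensity_eq_integral_toReal_smul
      hmodel.measurable_prior.ennreal_ofReal hfin, hsmul, diffEntropy, neg_neg]

/-! ### The Gaussian reference density -/

/-- The isotropic Gaussian density on `ℝ^d` with variance `1 / (2b)` in each coordinate. -/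
noncomputable def gaussianDensity (d : ℕ) (b : ℝ) (v : Space d) : ℝ :=
  Real.exp (-b * ‖v‖ ^ 2) / (Real.pi / b) ^ ((d : ℝ) / 2)

theorem measurable_gaussianDensity (d : ℕ) (b : ℝ) : Measurable (gaussianDensity d b) := by
  unfold gaussianDensity
  fun_prop

theorem gaussianDensity_pos {b : ℝ} (hb : 0 < b) (v : Space d) : 0 < gaussianDensity d b v :=
  div_pos (Real.exp_pos _) (Real.rpow_pos_of_pos (div_pos Real.pi_pos hb) _)

theorem lintegral_gaussianDensity {b : ℝ} (hb : 0 < b) :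
    ∫⁻ v : Space d, ENNReal.ofReal (gaussianDensity d b v) = 1 := by
  have hone : ∫ v : Space d, gaussianDensity d b v = 1 := by
    have h := GaussianFourier.integral_rexp_neg_mul_sq_norm (V := Space d) hb
    rw [finrank_euclideanSpace_fin] at h
    unfold gaussianDensity
    rw [integral_div, h, div_self (Real.rpow_pos_of_pos (div_pos Real.pi_pos hb) _).ne']
  rw [← ofReal_integral_eq_lintegral_ofReal (integrable_of_integral_eq_one hone)
    (Filter.Eventually.of_forall fun v => (gaussianDensity_pos hb v).le), hone,
    ENNReal.ofReal_one]

/-- A Gaussian centred at a function of the seed, relative to the prior, has total mass at most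
one. -/
theorem IsTargetModel.lintegral_gaussianDensity_div_prior_le [IsProbabilityMeasure P]
    (hmodel : IsTargetModel P p₀ X U Y) {b : ℝ} (hb : 0 < b) {f : 𝒰 → Space d}
    (hf : Measurable f) :
    ∫⁻ ω, ENNReal.ofReal (gaussianDensity d b (X ω - f (U ω)) / p₀ (X ω)) ∂P ≤ 1 := by
  have hX := hmodel.measurable_target
  have hU := hmodel.measurable_seed
  have hp := hmodel.measurable_prior
  set F : 𝒰 × Space d → ℝ≥0∞ :=
    fun q => ENNReal.ofReal (gaussianDensity d b (q.2 - f q.1) / p₀ q.2) with hF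
  have hFm : Measurable F :=
    (((measurable_gaussianDensity d b).comp
      (measurable_snd.sub (hf.comp measurable_fst))).div (hp.comp measurable_snd)).ennreal_ofReal
  have := Measure.isProbabilityMeasure_map (μ := P) hX.aemeasurable
  have := Measure.isProbabilityMeasure_map (μ := P) hU.aemeasurable
  have hmap := (indepFun_iff_map_prod_eq_prod_map_map hU.aemeasurable hX.aemeasurable).mp
    hmodel.indep_seed
  calc ∫⁻ ω, F (U ω, X ω) ∂P = ∫⁻ q, F q ∂(P.map fun ω => (U ω, X ω)) :=
        (lintegral_map hFm (hU.prodMk hX)).symm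
    _ = ∫⁻ u, ∫⁻ x, F (u, x) ∂P.map X ∂P.map U := by
        rw [hmap, lintegral_prod _ hFm.aemeasurable]
    _ ≤ ∫⁻ _, 1 ∂P.map U := by
        refine lintegral_mono fun u => ?_
        have hFu : Measurable fun x => F (u, x) := hFm.comp measurable_prodMk_left
        rw [hmodel.map_target, lintegral_withDensity_eq_lintegral_mul _ hp.ennreal_ofReal hFu]
        calc ∫⁻ x, ENNReal.ofReal (p₀ x) * F (u, x)
            ≤ ∫⁻ x, ENNReal.ofReal (gaussianDensity d b (x - f u)) := by
              refine lintegral_mono fun x => ?_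
              simp only [hF]
              rw [← ENNReal.ofReal_mul (hmodel.prior_nonneg x)]
              refine ENNReal.ofReal_le_ofReal ?_
              -- Where the prior vanishes, the left side is 0 and Gaussian mass is lost; hence an
              -- inequality rather than equality.
              rcases (hmodel.prior_nonneg x).eq_or_lt with h | h
              · rw [← h, zero_mul]
                exact (gaussianDensity_pos hb _).le
              · rw [mul_div_cancel₀ _ h.ne']
          _ = 1 := by
              rw [lintegral_sub_right_eq_self
                (fun v => ENNReal.ofReal (gaussianDensity d b v)) (f u),
                lintegral_gaussianDensity hb]
    _ = 1 := by simp

/-! ### Gibbs' inequality and the optimal variance -/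

/-- Gibbs' inequality between the joint law of target, seed and responses and the law under which
the responses are uniform and the target is Gaussian around its estimate. -/
theorem HasResponseLaw.entropy_le [IsProbabilityMeasure P] {ζ : SequentialPolicy d M 𝒰}
    (hε : ∀ m, ε m ∈ Set.Ioo (0 : ℝ) (1 / 2)) (hmodel : IsTargetModel P p₀ X U Y)
    (hH : HasFiniteEntropy p₀) (hlaw : HasResponseLaw P ε ζ X U Y) {n : ℕ}
    (e : Estimator d M 𝒰 n) (hmse : mse P X (e.estimate U Y) ≠ ∞) {b : ℝ} (hb : 0 < b) :
    diffEntropy p₀ - n * ∑ m, capacity (ε m) ≤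
      (d : ℝ) / 2 * Real.log (Real.pi / b) + b * (mse P X (e.estimate U Y)).toReal := by
  obtain ⟨N, hN⟩ : ∃ N : ℝ, N = ((Fintype.card (Record M n) : ℕ) : ℝ) := ⟨_, rfl⟩
  have hN0 : 0 < N := hN ▸ Nat.cast_pos.mpr Fintype.card_pos
  have hlogN : Real.log N = n * (M * Real.log 2) := by
    simp [hN]
  have hp := hmodel.measurable_prior
  -- Density of the reference law relative to the true law, for the record `h`.
  set z : Record M n → 𝒰 × Space d → ℝ := fun h q =>
    gaussianDensity d b (q.2 - e.toFun h q.1) / p₀ q.2 / N / ζ.recordLikelihood ε h q with hz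
  have hzm : ∀ h, Measurable (z h) := fun h =>
    ((((measurable_gaussianDensity d b).comp
      (measurable_snd.sub ((e.measurable_toFun h).comp measurable_fst))).div
        (hp.comp measurable_snd)).div_const N).div (ζ.measurable_recordLikelihood ε h)
  set Z : Ω → ℝ := fun ω => z (record Y n ω) (U ω, X ω) with hZ
  have hZm : Measurable Z := measurable_uncurry_record hmodel hzm
  have hZ0 : 0 ≤ Z := fun ω => div_nonneg (div_nonneg (div_nonneg (gaussianDensity_pos hb _).le
    (hmodel.prior_nonneg _)) hN0.le) (ζ.recordLikelihood_pos hε _ _).le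
  have hZlint : ∫⁻ ω, ENNReal.ofReal (Z ω) ∂P ≤ 1 := by
    rw [hZ, hlaw.lintegral_record hε hmodel (w := fun h q => ENNReal.ofReal (z h q))
      fun h => (hzm h).ennreal_ofReal]
    -- The likelihood cancels. For a fixed record the centre of the Gaussian depends on the seed
    -- alone, which is independent of the target, so each record contributes at most 1/N.
    calc _ ≤ ∑ _h : Record M n, ENNReal.ofReal (1 / N) := by
          refine Finset.sum_le_sum fun h _ => ?_
          have : ∀ ω, ENNReal.ofReal (ζ.recordLikelihood ε h (U ω, X ω)) *
              ENNReal.ofReal (z h (U ω, X ω)) = ENNReal.ofReal (1 / N) *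
                ENNReal.ofReal (gaussianDensity d b (X ω - e.toFun h (U ω)) / p₀ (X ω)) := by
            intro ω
            rw [← ENNReal.ofReal_mul (ζ.recordLikelihood_pos hε _ _).le,
              ← ENNReal.ofReal_mul (by positivity)]
            congr 1
            rw [hz]
            dsimp only
            rw [mul_div_cancel₀ _ (ζ.recordLikelihood_pos hε _ _).ne']
            ring
          simp_rw [this]
          rw [lintegral_const_mul' _ _ ENNReal.ofReal_ne_top]
          exact mul_le_of_le_one_right' (hmodel.lintegral_gaussianDensity_div_prior_le hb
            (e.measurable_toFun h))
      _ = 1 := by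
          rw [Finset.sum_const, nsmul_eq_mul, Finset.card_univ, ← ENNReal.ofReal_natCast, ← hN,
            ← ENNReal.ofReal_mul hN0.le, mul_one_div_cancel hN0.ne', ENNReal.ofReal_one]
  have hZint : Integrable Z P := (lintegral_ofReal_ne_top_iff_integrable
    hZm.aestronglyMeasurable (Filter.Eventually.of_forall hZ0)).mp
      (ne_top_of_le_ne_top ENNReal.one_ne_top hZlint)
  have hZle : ∫ ω, Z ω ∂P ≤ 1 := by
    rw [integral_eq_lintegral_of_nonneg_ae (Filter.Eventually.of_forall hZ0)
      hZm.aestronglyMeasurable]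
    exact ENNReal.toReal_le_of_le_ofReal zero_le_one (by simpa using hZlint)
  set r : Ω → ℝ := fun ω => ‖X ω - e.estimate U Y ω‖ ^ 2 with hr
  have hrm : Measurable r := measurable_uncurry_record hmodel
    (w := fun h q => ‖q.2 - e.toFun h q.1‖ ^ 2) fun h =>
      ((measurable_snd.sub ((e.measurable_toFun h).comp measurable_fst)).norm.pow_const 2)
  have hr0 : 0 ≤ r := fun ω => sq_nonneg _
  have hrint : Integrable r P := (lintegral_ofReal_ne_top_iff_integrable
    hrm.aestronglyMeasurable (Filter.Eventually.of_forall hr0)).mp hmse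
  have hrval : ∫ ω, r ω ∂P = (mse P X (e.estimate U Y)).toReal :=
    integral_eq_lintegral_of_nonneg_ae (Filter.Eventually.of_forall hr0)
      hrm.aestronglyMeasurable
  obtain ⟨hpint, hpval⟩ := hmodel.integral_log_prior hH
  obtain ⟨hℓint, hℓval⟩ := hlaw.integral_log_recordLikelihood hε hmodel n
  set c : ℝ := -((d : ℝ) / 2 * Real.log (Real.pi / b)) - n * (M * Real.log 2) with hc
  -- The left side is log Z written out, with `c` collecting the Gaussian normalization and -log N.
  have hpt : ∀ᵐ ω ∂P, c - b * r ω - Real.log (p₀ (X ω)) -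
      Real.log (ζ.recordLikelihood ε (record Y n ω) (U ω, X ω)) ≤ Z ω - 1 := by
    filter_upwards [hmodel.ae_prior_pos] with ω hω
    have hπ : 0 < Real.pi / b := div_pos Real.pi_pos hb
    have hg := gaussianDensity_pos hb (X ω - e.toFun (record Y n ω) (U ω))
    have hℓ := ζ.recordLikelihood_pos hε (record Y n ω) (U ω, X ω)
    have hZpos : 0 < Z ω := div_pos (div_pos (div_pos hg hω) hN0) hℓ
    refine le_trans (le_of_eq ?_) (Real.log_le_sub_one_of_pos hZpos)
    have h1 : Real.log (Z ω) = Real.log (gaussianDensity d b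
        (X ω - e.toFun (record Y n ω) (U ω))) - Real.log (p₀ (X ω)) - Real.log N -
        Real.log (ζ.recordLikelihood ε (record Y n ω) (U ω, X ω)) := by
      simp only [hZ, hz]
      rw [Real.log_div (div_pos (div_pos hg hω) hN0).ne' hℓ.ne',
        Real.log_div (div_pos hg hω).ne' hN0.ne', Real.log_div hg.ne' hω.ne']
    have h2 : Real.log (gaussianDensity d b (X ω - e.toFun (record Y n ω) (U ω))) =
        -b * r ω - (d : ℝ) / 2 * Real.log (Real.pi / b) := by
      unfold gaussianDensity
      rw [Real.log_div (Real.exp_pos _).ne' (Real.rpow_pos_of_pos hπ _).ne', Real.log_exp,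
        Real.log_rpow hπ]
      rfl
    rw [h1, h2, hlogN]
    ring
  have hi1 : Integrable (fun ω => c - b * r ω) P := (integrable_const c).sub (hrint.const_mul b)
  have hi2 : Integrable (fun ω => c - b * r ω - Real.log (p₀ (X ω))) P := hi1.sub hpint
  have hmono := integral_mono_ae (hi2.sub hℓint) (hZint.sub (integrable_const 1)) hpt
  have hL : ∫ ω, (c - b * r ω - Real.log (p₀ (X ω)) -
      Real.log (ζ.recordLikelihood ε (record Y n ω) (U ω, X ω))) ∂P =
      c - b * (mse P X (e.estimate U Y)).toReal + diffEntropy p₀ +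
        n * ∑ m, Real.binEntropy (ε m) := by
    rw [integral_sub hi2 hℓint, integral_sub hi1 hpint,
      integral_sub (integrable_const c) (hrint.const_mul b), integral_const_mul, hrval, hpval,
      hℓval]
    simp
  have hR : ∫ ω, (Z ω - 1) ∂P = ∫ ω, Z ω ∂P - 1 := by
    rw [integral_sub hZint (integrable_const 1)]
    simp
  have hcap : ∑ m, capacity (ε m) = M * Real.log 2 - ∑ m, Real.binEntropy (ε m) := by
    simp [capacity, Finset.sum_sub_distrib]
  have hfinal := (hL.symm.trans_le hmono).trans_eq hR
  rw [hcap, mul_sub]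
  rw [hc] at hfinal
  linarith

theorem HasResponseLaw.mseBound_le_mse [IsProbabilityMeasure P] {ζ : SequentialPolicy d M 𝒰}
    (hd : 0 < d) (hε : ∀ m, ε m ∈ Set.Ioo (0 : ℝ) (1 / 2)) (hmodel : IsTargetModel P p₀ X U Y)
    (hH : HasFiniteEntropy p₀) (hlaw : HasResponseLaw P ε ζ X U Y) {n : ℕ}
    (e : Estimator d M 𝒰 n) :
    ENNReal.ofReal (mseBound p₀ ε n) ≤ mse P X (e.estimate U Y) := by
  by_cases hmse : mse P X (e.estimate U Y) = ∞
  · rw [hmse]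
    exact le_top
  have hd' : (0 : ℝ) < d := Nat.cast_pos.mpr hd
  set A : ℝ := diffEntropy p₀ - n * ∑ m, capacity (ε m) with hA
  -- With s = π/b, the entropy inequality reads MSE ≥ (s/π)(A - (d/2) log s). The right side is
  -- largest at log s = 2A/d - 1, with value ds/(2π).
  set s : ℝ := Real.exp (2 * A / d - 1) with hs
  have hs0 : 0 < s := Real.exp_pos _
  have hb : 0 < Real.pi / s := div_pos Real.pi_pos hs0
  have key := hlaw.entropy_le hε hmodel hH e hmse hb
  rw [← hA, div_div_cancel₀ Real.pi_ne_zero, hs, Real.log_exp, ← hs] at key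
  have hbound : mseBound p₀ ε n = d * s / (2 * Real.pi) := by
    have : s = Real.exp (2 * diffEntropy p₀ / d) *
        Real.exp (-(2 * n * ∑ m, capacity (ε m)) / d) / Real.exp 1 := by
      rw [hs, hA, ← Real.exp_add, ← Real.exp_sub]
      congr 1
      ring
    rw [this, mseBound]
    field_simp
  rw [hbound]
  refine ENNReal.ofReal_le_of_le_toReal ?_
  have h1 : (d : ℝ) / 2 * (2 * A / d - 1) = A - d / 2 := by
    field_simp
  rw [h1] at key
  have h2 : (d : ℝ) / 2 ≤ Real.pi / s * (mse P X (e.estimate U Y)).toReal := by linarith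
  rw [div_mul_eq_mul_div, le_div_iff₀ hs0] at h2
  rw [div_le_iff₀ (by positivity)]
  linarith

end LowerBound

end TwentyQuestions

theorem theorem4 {Ω 𝒰 : Type*} [MeasurableSpace Ω] [MeasurableSpace 𝒰]
    (P : Measure Ω) [IsProbabilityMeasure P] {d M : ℕ} (hd : 0 < d)
    (p₀ : TwentyQuestions.Space d → ℝ) (ε : Fin M → ℝ) (hε : ∀ m, ε m ∈ Set.Ioo (0 : ℝ) (1 / 2))
    (X : Ω → TwentyQuestions.Space d) (U : Ω → 𝒰) (Y : ℕ → Ω → Fin M → Bool)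
    (hmodel : TwentyQuestions.IsTargetModel P p₀ X U Y)
    (hH : TwentyQuestions.HasFiniteEntropy p₀) (n : ℕ) :
    -- joint policies: the posterior median, and every other estimator
    (∀ ζ : TwentyQuestions.JointPolicy d M 𝒰, TwentyQuestions.IsJointGame P ε ζ X U Y →
      (∀ Xn : TwentyQuestions.Estimator d M 𝒰 n,
        (∀ᵐ ω ∂P, TwentyQuestions.IsMedian
          (TwentyQuestions.posterior p₀ ε (ζ.asked U Y ω) (fun k => Y k ω) n)
          (Xn.estimate U Y ω)) →
        ENNReal.ofReal (TwentyQuestions.mseBound p₀ ε n) ≤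
          TwentyQuestions.mse P X (Xn.estimate U Y)) ∧
      (∀ Xn : TwentyQuestions.Estimator d M 𝒰 n,
        ENNReal.ofReal (TwentyQuestions.mseBound p₀ ε n) ≤
          TwentyQuestions.mse P X (Xn.estimate U Y))) ∧
    -- sequential policies: the posterior median, and every other estimator
    (∀ ζ : TwentyQuestions.SequentialPolicy d M 𝒰, TwentyQuestions.IsSequentialGame P ε ζ X U Y →
      (∀ Xn : TwentyQuestions.Estimator d M 𝒰 n,
        (∀ᵐ ω ∂P, TwentyQuestions.IsMedian
          (TwentyQuestions.posterior p₀ ε (ζ.asked U Y ω) (fun k => Y k ω) n)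
          (Xn.estimate U Y ω)) →
        ENNReal.ofReal (TwentyQuestions.mseBound p₀ ε n) ≤
          TwentyQuestions.mse P X (Xn.estimate U Y)) ∧
      (∀ Xn : TwentyQuestions.Estimator d M 𝒰 n,
        ENNReal.ofReal (TwentyQuestions.mseBound p₀ ε n) ≤
          TwentyQuestions.mse P X (Xn.estimate U Y))) := by
  have bound : ∀ (ζ : TwentyQuestions.SequentialPolicy d M 𝒰),
      TwentyQuestions.HasResponseLaw P ε ζ X U Y → ∀ Xn : TwentyQuestions.Estimator d M 𝒰 n,
        ENNReal.ofReal (TwentyQuestions.mseBound p₀ ε n) ≤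
          TwentyQuestions.mse P X (Xn.estimate U Y) :=
    fun _ hlaw Xn => hlaw.mseBound_le_mse hd hε hmodel hH Xn
  refine ⟨fun ζ hgame => ?_, fun ζ hgame => ?_⟩
  · have h := bound ζ.toSequential (hgame.hasResponseLaw hmodel)
    exact ⟨fun Xn _ => h Xn, h⟩
  · have h := bound ζ (hgame.hasResponseLaw hε hmodel)
    exact ⟨fun Xn _ => h Xn, h⟩
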